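/- Let $(\mathbb X,\|\cdot\|)$ be a quasi-Banach space over $\mathbb F=\mathbb R$ or $\mathbb C$. Let $\mathcal B=(e_n)_{n\ge1}$ be a semi-normalized Markushevich basis of $\mathbb X$: there are continuous linear functionals $e_n^*$ on $\mathbb X$ with $e_i^*(e_j)=\delta_{i,j}$, there are $0<c_1\le c_2<\infty$ with $c_1\le\|e_n\|,\|e_n^*\|_*\le c_2$ for all $n$, the linear span of $(e_n)$ is dense in $\mathbb X$, and $x=0$ whenever $e_n^*(x)=0$ for all $n$. Assume that $\mathcal B$ is unconditional, that is, the projections $P_A(x)=\sum_{n\in A}e_n^*(x)e_n$ satisfy $\sup_{|A|<\infty}\|P_A\|<\infty$. For $m\ge1$ and $x\in\mathbb X$ let $$\sigma_m(x)=\inf\Big\{\Big\|x-\sum_{n\in A}b_ne_n\Big\|: |A|=m,\ b_n\in\mathbb F\Big\},\qquad \gamma_m(x)=\sup_\pi\Big\|x-\sum_{n=1}^m e^*_{\pi(n)}(x)e_{\pi(n)}\Big\|,$$ where $\pi$ runs over the greedy orderings of $x$, i.e. the one-to-one maps $\pi:\mathbb N\to\mathbb N$ with $\{n:e_n^*(x)\ne0\}\subset\pi(\mathbb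 N)$ and $|e^*_{\pi(i)}(x)|\ge|e^*_{\pi(j)}(x)|$ whenever $i\le j$. The basis is greedy if $\gamma_m(x)\asymp\sigma_m(x)$ with constants independent of $x$ and $m$. Let $\omega=(\omega(n))_{n\ge1}$ be a doubling weight, i.e. $0<\omega(1)\le\omega(2)\le\cdots$, $\lim_n\omega(n)=\infty$, and there is $\theta\ge 1$ with $\omega(2n)\le\theta\,\omega(n)$ for all $n\ge1$. Assume that its lower dilation index is positive: $$i_\omega=\sup_{M>1}\frac{\ln\varphi_\omega(M)}{\ln M}>0,\qquad \varphi_\omega(M)=\inf_{k\ge1}\frac{\omega(Mk)}{\omega(k)}.$$ For $q\in(0,\infty)$ let $\mathcal A_q^\omega$ be the set of those $x\in\mathbb X$ for which $$\|x\|_{\mathcal A_q^\omega}=\|x\|+\Big[\sum_{n=1}^\infty(\omega(n)\sigma_n(x))^q\frac1n\Big]^{1/q}<\infty,$$ with the usual modification $\|x\|_{\mathcal A_\infty^\omega}=\|x\|+\sup_{n\ge1}\omega(n)\sigma_n(x)$ for $q=\infty$, and define $\mathcal G_q^\omega$ and $\|\cdot\|_{\mathcal G_q^\omega}$ in the same way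 with $\gamma_n$ in place of $\sigma_n$. Write $\mathcal A_q^\omega\approx\mathcal G_q^\omega$ if $\mathcal A_q^\omega=\mathcal G_q^\omega$ as sets and there is $C>0$ with $C^{-1}\|x\|_{\mathcal A_q^\omega}\le\|x\|_{\mathcal G_q^\omega}\le C\|x\|_{\mathcal A_q^\omega}$ for all $x$ in this set. Then: 1. If $\mathcal B$ is greedy, then $\mathcal A_q^\omega\approx\mathcal G_q^\omega$ for all $q\in(0,\infty]$. 2. If $\mathcal A_q^\omega\approx\mathcal G_q^\omega$ for some $q\in(0,\infty]$, then $\mathcal B$ is greedy. -/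

import Mathlib

open scoped ENNReal Topology

namespace GreedyApprox

/-- `X` with the function `‖·‖` is a quasi-Banach space over `𝕜` (`ℝ` or `ℂ`): `‖·‖` is a
quasi-norm, and `X` is complete for it. The quasi-norm is not assumed to be continuous. -/
class IsQuasiBanach (𝕜 X : Type*) [RCLike 𝕜] [AddCommGroup X] [Module 𝕜 X] [Norm X] : Prop where
  norm_nonneg : ∀ x : X, 0 ≤ ‖x‖
  norm_eq_zero : ∀ x : X, ‖x‖ = 0 ↔ x = 0
  norm_smul : ∀ (t : 𝕜) (x : X), ‖t • x‖ = ‖t‖ * ‖x‖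
  norm_add_le : ∃ κ : ℝ, 1 ≤ κ ∧ ∀ x y : X, ‖x + y‖ ≤ κ * (‖x‖ + ‖y‖)
  complete : ∀ u : ℕ → X,
    (∀ ε : ℝ, 0 < ε → ∃ N : ℕ, ∀ m n : ℕ, N ≤ m → N ≤ n → ‖u m - u n‖ < ε) →
      ∃ x : X, Filter.Tendsto (fun n => ‖u n - x‖) Filter.atTop (𝓝 0)

section Basis

variable {𝕜 X : Type*} [RCLike 𝕜] [AddCommGroup X] [Module 𝕜 X] [Norm X]

/-- The dual norm `‖f‖_* = sup {|f x| : ‖x‖ ≤ 1}` of a linear functional, with values in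
`[0, ∞]`; it is finite exactly when `f` is continuous. -/
noncomputable def dualNorm (f : X →ₗ[𝕜] 𝕜) : ℝ≥0∞ :=
  ⨆ (x : X) (_ : ‖x‖ ≤ 1), ENNReal.ofReal ‖f x‖

variable (𝕜 X) in
/-- A semi-normalized Markushevich basis: the vectors `e n` with their biorthogonal functionals
`coord n` (which `e` determines, by continuity and density of the span). -/
structure MBasis where
  /-- the basis vectors -/
  e : ℕ → X
  /-- the biorthogonal functionals `e_n^*` -/
  coord : ℕ → (X →ₗ[𝕜] 𝕜)
  biorthogonal : ∀ i j : ℕ, coord i (e j) = if i = j then 1 else 0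
  semi_normalized : ∃ c₁ c₂ : ℝ, 0 < c₁ ∧ ∀ n : ℕ,
    (c₁ ≤ ‖e n‖ ∧ ‖e n‖ ≤ c₂) ∧
    (ENNReal.ofReal c₁ ≤ dualNorm (coord n) ∧ dualNorm (coord n) ≤ ENNReal.ofReal c₂)
  dense_span : ∀ x : X, ∀ ε : ℝ, 0 < ε →
    ∃ y ∈ Submodule.span 𝕜 (Set.range e), ‖x - y‖ < ε
  total : ∀ x : X, (∀ n : ℕ, coord n x = 0) → x = 0

/-- The coordinate projection `P_A x = ∑_{n ∈ A} e_n^*(x) e_n`. -/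
noncomputable def MBasis.proj (B : MBasis 𝕜 X) (A : Finset ℕ) (x : X) : X :=
  ∑ n ∈ A, B.coord n x • B.e n

/-- The basis is unconditional: `sup_A ‖P_A‖ < ∞` over the finite sets `A`. -/
def MBasis.IsUnconditional (B : MBasis 𝕜 X) : Prop :=
  ∃ K : ℝ, ∀ (A : Finset ℕ) (x : X), ‖B.proj A x‖ ≤ K * ‖x‖

/-- The `m`-term error `σ_m(x) = inf {‖x - ∑_{n ∈ A} b_n e_n‖ : |A| = m, b_n ∈ 𝕜}`. -/
noncomputable def MBasis.sigma (B : MBasis 𝕜 X) (m : ℕ) (x : X) : ℝ≥0∞ :=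
  ⨅ (A : Finset ℕ) (_ : A.card = m) (b : ℕ → 𝕜),
    ENNReal.ofReal ‖x - ∑ n ∈ A, b n • B.e n‖

/-- `π` is a greedy ordering of `x`: it is one-to-one, its range contains the support of `x`, and
it lists the coefficients of `x` in nonincreasing order of modulus. (`π` is not required to be
onto: no bijection lists the coefficients in nonincreasing order if infinitely many of them are
nonzero and some of them vanish.) -/
structure MBasis.IsGreedyOrdering (B : MBasis 𝕜 X) (x : X) (π : ℕ → ℕ) : Prop where
  injective : Function.Injective π
  support_subset : ∀ n : ℕ, B.coord n x ≠ 0 → n ∈ Set.range π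
  antitone : ∀ i j : ℕ, i ≤ j → ‖B.coord (π j) x‖ ≤ ‖B.coord (π i) x‖

/-- The greedy sum of order `m`, i.e. the sum of the first `m` terms of `x` along `π`. -/
noncomputable def MBasis.greedySum (B : MBasis 𝕜 X) (π : ℕ → ℕ) (m : ℕ) (x : X) : X :=
  ∑ i ∈ Finset.range m, B.coord (π i) x • B.e (π i)

/-- The `m`-th greedy error `γ_m(x) = sup_π ‖x - G_m^π(x)‖` over the greedy orderings of `x`. -/
noncomputable def MBasis.gamma (B : MBasis 𝕜 X) (m : ℕ) (x : X) : ℝ≥0∞ :=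
  ⨆ (π : ℕ → ℕ) (_ : B.IsGreedyOrdering x π), ENNReal.ofReal ‖x - B.greedySum π m x‖

/-- The basis is greedy: `γ_m(x) ≍ σ_m(x)`, with constants independent of `x` and `m`. -/
def MBasis.IsGreedy (B : MBasis 𝕜 X) : Prop :=
  ∃ C : ℝ, 0 < C ∧ ∀ (x : X) (m : ℕ), 1 ≤ m →
    B.gamma m x ≤ ENNReal.ofReal C * B.sigma m x ∧
    B.sigma m x ≤ ENNReal.ofReal C * B.gamma m x

/-- For errors `err m x` and a weight `ω`, the quantity
`‖x‖ + (∑_{n ≥ 1} (ω(n) err_n(x))^q / n)^{1/q}`, or `‖x‖ + sup_{n ≥ 1} ω(n) err_n(x)` if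
`q = ∞`, in `[0, ∞]`. Only the values `ω n` with `n ≥ 1` are used. -/
noncomputable def classNorm (ω : ℕ → ℝ) (q : ℝ≥0∞) (err : ℕ → X → ℝ≥0∞) (x : X) : ℝ≥0∞ :=
  ENNReal.ofReal ‖x‖ +
    if q = ∞ then ⨆ n : ℕ, ENNReal.ofReal (ω (n + 1)) * err (n + 1) x
    else (∑' n : ℕ, (ENNReal.ofReal (ω (n + 1)) * err (n + 1) x) ^ q.toReal /
      ((n + 1 : ℕ) : ℝ≥0∞)) ^ (1 / q.toReal)

/-- `‖x‖` in the approximation space `𝒜_q^ω`, which consists of the `x` where it is finite. -/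
noncomputable def MBasis.approxNorm (B : MBasis 𝕜 X) (ω : ℕ → ℝ) (q : ℝ≥0∞) : X → ℝ≥0∞ :=
  classNorm ω q B.sigma

/-- `‖x‖` in the greedy class `𝒢_q^ω`, which consists of the `x` where it is finite. -/
noncomputable def MBasis.greedyNorm (B : MBasis 𝕜 X) (ω : ℕ → ℝ) (q : ℝ≥0∞) : X → ℝ≥0∞ :=
  classNorm ω q B.gamma

end Basis

section Embedding

variable {X : Type*}

/-- `Y ↪ Z` for `Y = {x : Φ x < ∞}` and `Z = {x : Ψ x < ∞}`: `Y ⊆ Z`, and there is `C > 0` with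
`Ψ x ≤ C Φ x` for all `x ∈ Y`. -/
def Embeds (Φ Ψ : X → ℝ≥0∞) : Prop :=
  {x | Φ x < ∞} ⊆ {x | Ψ x < ∞} ∧
    ∃ C : ℝ, 0 < C ∧ ∀ x : X, Φ x < ∞ → Ψ x ≤ ENNReal.ofReal C * Φ x

/-- `Y ≈ Z`: each of the two spaces embeds in the other one. -/
def EquivalentSpaces (Φ Ψ : X → ℝ≥0∞) : Prop :=
  Embeds Φ Ψ ∧ Embeds Ψ Φ

end Embedding

/-- Doubling weights `ω = (ω(n))_{n ≥ 1}`; the value `ω 0` is irrelevant. -/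
structure IsDoublingWeight (ω : ℕ → ℝ) : Prop where
  pos : ∀ n : ℕ, 1 ≤ n → 0 < ω n
  mono : ∀ m n : ℕ, 1 ≤ m → m ≤ n → ω m ≤ ω n
  tendsto : Filter.Tendsto ω Filter.atTop Filter.atTop
  doubling : ∃ θ : ℝ, 1 ≤ θ ∧ ∀ n : ℕ, 1 ≤ n → ω (2 * n) ≤ θ * ω n

/-- The lower dilation sequence `φ_ω(M) = inf_{k ≥ 1} ω(M k) / ω(k)`. -/
noncomputable def lowerDilation (ω : ℕ → ℝ) (M : ℕ) : ℝ :=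
  ⨅ k : ℕ, ω (M * (k + 1)) / ω (k + 1)

/-- The lower dilation index `i_ω = sup_{M > 1} ln φ_ω(M) / ln M`. -/
noncomputable def lowerDilationIndex (ω : ℕ → ℝ) : EReal :=
  ⨆ (M : ℕ) (_ : 1 < M), ((Real.log (lowerDilation ω M) / Real.log M : ℝ) : EReal)

end GreedyApprox

/-!
An unconditional basis is greedy as soon as it is democratic: on a greedy set the coefficients of
`x` dominate those of any other set of the same size, so democracy lets one exchange the two sets.

If `𝒜_q^ω` embeds in `𝒢_q^ω`, compare the two norms of `x = 𝟏_A + 2 𝟏_D`, where `|A| ≤ |D|`. The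
first `|D|` greedy steps only see `D`, hence `‖x‖_𝒢 ≳ ω(|D|) ‖𝟏_A‖`. Since `σ_n(x) ≲ ‖𝟏_D‖` for
`n ≥ |A|` and `σ_n(x) = 0` for `n ≥ |A| + |D|`, and since `i_ω > 0` makes the `ℓ^q` norm of
`ω(1), ..., ω(m)` comparable to `ω(m)`, also `‖x‖_𝒜 ≲ ω(|A|) ‖x‖ + ω(|D|) ‖𝟏_D‖`. When `|D|` is a
large multiple of `|A|`, the part of `ω(|A|) ‖x‖` coming from `𝟏_A` is absorbed by the left-hand
side, so `‖𝟏_A‖ ≲ ‖𝟏_D‖`; cutting `A` into boundedly many pieces yields democracy.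
-/

namespace GreedyApprox

open Filter MeasureTheory
open scoped NNReal

section QuasiNorm

/-- The function `‖·‖` on the `𝕜`-vector space `X` is a quasi-norm: the axioms of `IsQuasiBanach`
except completeness. -/
class IsQuasiNorm (𝕜 X : Type*) [RCLike 𝕜] [AddCommGroup X] [Module 𝕜 X] [Norm X] : Prop where
  norm_nonneg : ∀ x : X, 0 ≤ ‖x‖
  norm_eq_zero : ∀ x : X, ‖x‖ = 0 ↔ x = 0
  norm_smul : ∀ (t : 𝕜) (x : X), ‖t • x‖ = ‖t‖ * ‖x‖
  norm_add_le : ∃ κ : ℝ, 1 ≤ κ ∧ ∀ x y : X, ‖x + y‖ ≤ κ * (‖x‖ + ‖y‖)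

instance IsQuasiBanach.isQuasiNorm {𝕜 X : Type*} [RCLike 𝕜] [AddCommGroup X] [Module 𝕜 X]
    [Norm X] [IsQuasiBanach 𝕜 X] : IsQuasiNorm 𝕜 X where
  norm_nonneg := IsQuasiBanach.norm_nonneg 𝕜
  norm_eq_zero := IsQuasiBanach.norm_eq_zero 𝕜
  norm_smul := IsQuasiBanach.norm_smul
  norm_add_le := IsQuasiBanach.norm_add_le 𝕜

/-- `κ` is a modulus of concavity of `‖·‖`, i.e. a constant in its quasi-triangle inequality. -/
structure IsConcavityModulus (X : Type*) [Add X] [Norm X] (κ : ℝ) : Prop where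
  one_le : 1 ≤ κ
  norm_add_le : ∀ x y : X, ‖x + y‖ ≤ κ * (‖x‖ + ‖y‖)

theorem IsQuasiNorm.exists_isConcavityModulus (𝕜 X : Type*) [RCLike 𝕜] [AddCommGroup X]
    [Module 𝕜 X] [Norm X] [IsQuasiNorm 𝕜 X] : ∃ κ, IsConcavityModulus X κ :=
  let ⟨κ, hκ, hadd⟩ := IsQuasiNorm.norm_add_le 𝕜 (X := X)
  ⟨κ, hκ, hadd⟩

variable (𝕜 : Type*) {X : Type*} [RCLike 𝕜] [AddCommGroup X] [Module 𝕜 X] [Norm X]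

theorem IsQuasiNorm.norm_zero [IsQuasiNorm 𝕜 X] : ‖(0 : X)‖ = 0 :=
  (IsQuasiNorm.norm_eq_zero 𝕜 0).2 rfl

theorem IsQuasiNorm.norm_neg [IsQuasiNorm 𝕜 X] (x : X) : ‖-x‖ = ‖x‖ := by
  simpa using IsQuasiNorm.norm_smul (-1 : 𝕜) x

namespace IsConcavityModulus

variable {X ι : Type*} [AddCommMonoid X] [Norm X] {κ M : ℝ}

theorem norm_zero_nonneg (hκ : IsConcavityModulus X κ) : 0 ≤ ‖(0 : X)‖ := by
  have h := hκ.norm_add_le 0 0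
  rw [add_zero] at h
  nlinarith [hκ.one_le]

theorem norm_sum_le_of_card_le_mul (hκ : IsConcavityModulus X κ) (v : ι → X) (d k : ℕ)
    {s : Finset ι} (hs : s.card ≤ k * d) (hv : ∀ t ⊆ s, t.card ≤ d → ‖∑ i ∈ t, v i‖ ≤ M) :
    ‖∑ i ∈ s, v i‖ ≤ (2 * κ) ^ k * M := by
  classical
  have hκ1 := hκ.one_le
  have hM : 0 ≤ M := hκ.norm_zero_nonneg.trans
    (by simpa using hv ∅ (Finset.empty_subset s) (Nat.zero_le d))
  have hone : ∀ j : ℕ, M ≤ (2 * κ) ^ j * M := fun j =>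
    le_mul_of_one_le_left hM (one_le_pow₀ (by linarith))
  induction k generalizing s with
  | zero => simpa using hv s subset_rfl (by lia)
  | succ k ih =>
    by_cases hd : s.card ≤ d
    · exact (hv s subset_rfl hd).trans (hone _)
    obtain ⟨t, hts, htd⟩ := Finset.exists_subset_card_eq (le_of_not_ge hd)
    have hcard : (s \ t).card ≤ k * d := by
      rw [Finset.card_sdiff_of_subset hts, htd]
      rw [Nat.succ_mul] at hs
      lia
    have hrest : ‖∑ i ∈ s \ t, v i‖ ≤ (2 * κ) ^ k * M :=
      ih hcard fun u hu => hv u (hu.trans Finset.sdiff_subset)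
    calc ‖∑ i ∈ s, v i‖ = ‖∑ i ∈ s \ t, v i + ∑ i ∈ t, v i‖ := by rw [Finset.sum_sdiff hts]
      _ ≤ κ * (‖∑ i ∈ s \ t, v i‖ + ‖∑ i ∈ t, v i‖) := hκ.norm_add_le _ _
      _ ≤ κ * ((2 * κ) ^ k * M + (2 * κ) ^ k * M) := by
        gcongr
        exact (hv t hts htd.le).trans (hone k)
      _ = (2 * κ) ^ (k + 1) * M := by ring

theorem norm_sum_le_of_forall_le (hκ : IsConcavityModulus X κ) (h0 : ‖(0 : X)‖ ≤ M)
    (s : Finset ι) {v : ι → X} (hv : ∀ i ∈ s, ‖v i‖ ≤ M) :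
    ‖∑ i ∈ s, v i‖ ≤ (2 * κ) ^ s.card * M := by
  refine hκ.norm_sum_le_of_card_le_mul v 1 s.card (mul_one _).ge fun t hts ht => ?_
  rcases t.eq_empty_or_nonempty with rfl | hne
  · simpa using h0
  · obtain ⟨i, rfl⟩ := Finset.card_eq_one.1 (ht.antisymm hne.card_pos)
    simpa using hv i (by simpa using hts)

/-- Split the multiples into `b` layers, the `j`-th one consisting of the `n` with `j < d n`. -/
theorem norm_sum_nsmul_le (hκ : IsConcavityModulus X κ) {F : Finset ι} {y : ι → X}
    (hF : ∀ G ⊆ F, ‖∑ n ∈ G, y n‖ ≤ M) {b : ℕ} {d : ι → ℕ} (hd : ∀ n ∈ F, d n ≤ b) :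
    ‖∑ n ∈ F, d n • y n‖ ≤ (2 * κ) ^ b * M := by
  have hlayers : ∑ n ∈ F, d n • y n = ∑ j ∈ Finset.range b, ∑ n ∈ F with j < d n, y n := by
    simp_rw [Finset.sum_filter]
    rw [Finset.sum_comm]
    refine Finset.sum_congr rfl fun n hn => ?_
    have hrange : {j ∈ Finset.range b | j < d n} = Finset.range (d n) := by
      ext j
      have := hd n hn
      simp only [Finset.mem_filter, Finset.mem_range]
      lia
    rw [← Finset.sum_filter, Finset.sum_const, hrange, Finset.card_range]
  rw [hlayers]
  simpa only [Finset.card_range] using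
    hκ.norm_sum_le_of_forall_le (by simpa using hF ∅ F.empty_subset) (Finset.range b)
      fun j _ => hF _ (Finset.filter_subset _ _)

end IsConcavityModulus

end QuasiNorm

section Multipliers

theorem le_of_forall_exists_le_add_div_two {α : Type*} {s : Set α} {f : α → ℝ} {C : ℝ}
    (hbdd : BddAbove (f '' s)) (h : ∀ a ∈ s, ∃ a' ∈ s, f a ≤ (C + f a') / 2) {a : α} (ha : a ∈ s) :
    f a ≤ C := by
  have hle : ∀ a' ∈ s, f a' ≤ sSup (f '' s) := fun a' ha' =>
    le_csSup hbdd (Set.mem_image_of_mem f ha')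
  have hsup : sSup (f '' s) ≤ (C + sSup (f '' s)) / 2 := by
    refine csSup_le ⟨f a, Set.mem_image_of_mem f ha⟩ (Set.forall_mem_image.2 fun a' ha' => ?_)
    obtain ⟨a'', ha'', hstep⟩ := h a' ha'
    linarith [hle a'' ha'']
  linarith [hle a ha]

variable {𝕜 X ι : Type*} [RCLike 𝕜] [AddCommGroup X] [Module 𝕜 X] [Norm X] [IsQuasiNorm 𝕜 X]
  {κ M : ℝ} {F : Finset ι} {y : ι → X}

/-- Splitting off the first digit in base `b ≥ 2 κ` bounds the norm for `a` by the mean of the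
claimed bound and the norm for another family in `[0, 1]`. -/
theorem norm_sum_ofReal_smul_le (hκ : IsConcavityModulus X κ)
    (hF : ∀ G ⊆ F, ‖∑ n ∈ G, y n‖ ≤ M) {b : ℕ} (hb : 2 * κ ≤ b) {a : ι → ℝ}
    (ha : ∀ n ∈ F, a n ∈ Set.Icc (0 : ℝ) 1) :
    ‖∑ n ∈ F, (a n : 𝕜) • y n‖ ≤ (2 * κ) ^ b * M := by
  have h0 : ‖(0 : X)‖ ≤ M := by simpa using hF ∅ F.empty_subset
  have hM : 0 ≤ M := hκ.norm_zero_nonneg.trans h0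
  have hκ1 := hκ.one_le
  have hb0 : (0 : ℝ) < b := by linarith
  refine le_of_forall_exists_le_add_div_two (s := {a : ι → ℝ | ∀ n ∈ F, a n ∈ Set.Icc (0 : ℝ) 1})
    (f := fun a => ‖∑ n ∈ F, (a n : 𝕜) • y n‖)
    ⟨(2 * κ) ^ F.card * M, Set.forall_mem_image.2 fun a ha => ?_⟩ (fun a ha => ?_) ha
  · refine hκ.norm_sum_le_of_forall_le h0 F fun n hn => ?_
    rw [IsQuasiNorm.norm_smul, RCLike.norm_ofReal, abs_of_nonneg (ha n hn).1]
    have hyn : ‖y n‖ ≤ M := by simpa using hF {n} (by simpa using hn)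
    exact (mul_le_of_le_one_left (IsQuasiNorm.norm_nonneg 𝕜 _) (ha n hn).2).trans hyn
  · obtain ⟨d, r, hdr, hd, hr⟩ : ∃ (d : ι → ℕ) (r : ι → ℝ), (∀ n, a n * b = d n + r n) ∧
        (∀ n ∈ F, d n ≤ b) ∧ ∀ n ∈ F, r n ∈ Set.Icc (0 : ℝ) 1 := by
      refine ⟨fun n => ⌊a n * b⌋₊, fun n => a n * b - ⌊a n * b⌋₊, fun n => by ring,
        fun n hn => Nat.floor_le_of_le (mul_le_of_le_one_left hb0.le (ha n hn).2),
        fun n hn => ⟨sub_nonneg.2 (Nat.floor_le (mul_nonneg (ha n hn).1 hb0.le)), ?_⟩⟩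
      linarith [Nat.lt_floor_add_one (a n * b)]
    have hsplit : ∑ n ∈ F, (a n : 𝕜) • y n =
        (b : 𝕜)⁻¹ • (∑ n ∈ F, d n • y n + ∑ n ∈ F, (r n : 𝕜) • y n) := by
      rw [← Finset.sum_add_distrib, Finset.smul_sum]
      refine Finset.sum_congr rfl fun n _ => ?_
      have hdigit : (a n : 𝕜) * b = d n + r n := by
        exact_mod_cast congrArg (fun t : ℝ => (t : 𝕜)) (hdr n)
      have hb0' : (b : 𝕜) ≠ 0 := by exact_mod_cast hb0.ne'
      rw [← Nat.cast_smul_eq_nsmul 𝕜, ← add_smul, smul_smul, ← hdigit, mul_comm,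
        mul_inv_cancel_right₀ hb0']
    refine ⟨r, hr, ?_⟩
    have hr0 := IsQuasiNorm.norm_nonneg 𝕜 (∑ n ∈ F, (r n : 𝕜) • y n)
    rw [hsplit, IsQuasiNorm.norm_smul, norm_inv, RCLike.norm_natCast, inv_mul_le_iff₀ hb0]
    calc ‖∑ n ∈ F, d n • y n + ∑ n ∈ F, (r n : 𝕜) • y n‖
        ≤ κ * (‖∑ n ∈ F, d n • y n‖ + ‖∑ n ∈ F, (r n : 𝕜) • y n‖) := hκ.norm_add_le _ _
      _ ≤ κ * ((2 * κ) ^ b * M + ‖∑ n ∈ F, (r n : 𝕜) • y n‖) := by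
        gcongr
        exact hκ.norm_sum_nsmul_le hF hd
      _ = 2 * κ * (((2 * κ) ^ b * M + ‖∑ n ∈ F, (r n : 𝕜) • y n‖) / 2) := by ring
      _ ≤ b * (((2 * κ) ^ b * M + ‖∑ n ∈ F, (r n : 𝕜) • y n‖) / 2) := by gcongr

theorem norm_sum_smul_le (hκ : IsConcavityModulus X κ) (hF : ∀ G ⊆ F, ‖∑ n ∈ G, y n‖ ≤ M) {b : ℕ}
    (hb : 2 * κ ≤ b) {a : ι → 𝕜} (ha : ∀ n ∈ F, ‖a n‖ ≤ 1) :
    ‖∑ n ∈ F, a n • y n‖ ≤ (2 * κ) ^ 4 * ((2 * κ) ^ b * M) := by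
  have hM : 0 ≤ M := hκ.norm_zero_nonneg.trans (by simpa using hF ∅ F.empty_subset)
  have hκ1 := hκ.one_le
  let u : Fin 4 → ι → ℝ := ![fun n => (RCLike.re (a n))⁺, fun n => (RCLike.re (a n))⁻,
    fun n => (RCLike.im (a n))⁺, fun n => (RCLike.im (a n))⁻]
  let s : Fin 4 → 𝕜 := ![1, -1, RCLike.I, -RCLike.I]
  have hsplit : ∑ n ∈ F, a n • y n = ∑ i : Fin 4, s i • ∑ n ∈ F, (u i n : 𝕜) • y n := by
    simp_rw [Finset.smul_sum]
    rw [Finset.sum_comm]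
    refine Finset.sum_congr rfl fun n _ => ?_
    simp_rw [smul_smul, ← Finset.sum_smul]
    have hparts : ∀ t : ℝ, ((t⁺ : ℝ) : 𝕜) - ((t⁻ : ℝ) : 𝕜) = (t : 𝕜) := fun t => by
      rw [← RCLike.ofReal_sub, posPart_sub_negPart]
    congr 1
    simp only [Fin.sum_univ_four, s, u, Matrix.cons_val]
    linear_combination (-1 : 𝕜) * RCLike.re_add_im (a n) - hparts (RCLike.re (a n))
      - RCLike.I * hparts (RCLike.im (a n))
  have hs : ∀ i, ‖s i‖ ≤ 1 := by
    have hI : ‖(RCLike.I : 𝕜)‖ ≤ 1 := by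
      rcases eq_or_ne (RCLike.I : 𝕜) 0 with h | h
      · simp [h]
      · exact (RCLike.norm_I_of_ne_zero h).le
    intro i
    fin_cases i <;> simp [s, hI]
  have hu : ∀ i, ∀ n ∈ F, u i n ∈ Set.Icc (0 : ℝ) 1 := by
    intro i n hn
    have hre := abs_le.1 ((RCLike.abs_re_le_norm (a n)).trans (ha n hn))
    have him := abs_le.1 ((RCLike.abs_im_le_norm (a n)).trans (ha n hn))
    fin_cases i <;> simp [u, posPart_def, negPart_def] <;> linarith
  rw [hsplit]
  refine hκ.norm_sum_le_of_forall_le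
    ((IsQuasiNorm.norm_zero 𝕜).trans_le (by positivity)) Finset.univ fun i _ => ?_
  rw [IsQuasiNorm.norm_smul]
  exact (mul_le_of_le_one_left (IsQuasiNorm.norm_nonneg 𝕜 _) (hs i)).trans
    (norm_sum_ofReal_smul_le hκ hF hb (hu i))

end Multipliers

section Rearrangement

variable {ι : Type*} [Infinite ι] {c : ι → ℝ}

theorem exists_notMem_forall_le (hc : ∀ i, 0 ≤ c i) (h : Tendsto c cofinite (𝓝 0))
    (s : Finset ι) : ∃ i ∉ s, ∀ j ∉ s, c j ≤ c i := by
  by_cases hpos : ∃ i ∉ s, 0 < c i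
  · obtain ⟨i, hi, hci⟩ := hpos
    have hfin : {j | c i ≤ c j ∧ j ∉ s}.Finite := by
      have hlt := eventually_cofinite.1 (h.eventually (gt_mem_nhds hci))
      exact hlt.subset fun j hj => not_lt.2 hj.1
    obtain ⟨j, hj, hmax⟩ := Set.exists_max_image _ c hfin ⟨i, le_rfl, hi⟩
    exact ⟨j, hj.2, fun k hk => (le_total (c i) (c k)).elim (fun hik => hmax k ⟨hik, hk⟩)
      fun hki => hki.trans hj.1⟩
  · push Not at hpos
    obtain ⟨i, hi⟩ := Infinite.exists_notMem_finset s
    exact ⟨i, hi, fun j hj => (hpos j hj).trans (hc i)⟩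

theorem exists_injective_antitone (hc : ∀ i, 0 ≤ c i) (h : Tendsto c cofinite (𝓝 0)) :
    ∃ π : ℕ → ι, Function.Injective π ∧ Function.support c ⊆ Set.range π ∧ Antitone (c ∘ π) := by
  classical
  choose g hg hmax using exists_notMem_forall_le hc h
  let S : ℕ → Finset ι := fun k => (fun s => insert (g s) s)^[k] ∅
  have hsucc : ∀ k, S (k + 1) = insert (g (S k)) (S k) := fun k =>
    Function.iterate_succ_apply' _ k ∅
  have hmono : Monotone S := monotone_nat_of_le_succ fun k => by
    rw [hsucc]
    exact Finset.subset_insert _ _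
  have hmem : ∀ i j, i < j → g (S i) ∈ S j := fun i j hij =>
    hmono (Nat.succ_le_of_lt hij) (by rw [hsucc]; exact Finset.mem_insert_self _ _)
  have hinj : Function.Injective fun k => g (S k) :=
    Function.Injective.of_lt_imp_ne fun i j hij heq => hg (S j) (heq ▸ hmem i j hij)
  have hrange : ∀ k, ∀ n ∈ S k, n ∈ Set.range fun k => g (S k) := by
    intro k
    induction k with
    | zero => simp [S]
    | succ k ih =>
      rw [hsucc, Finset.forall_mem_insert]
      exact ⟨⟨k, rfl⟩, ih⟩
  refine ⟨fun k => g (S k), hinj, fun n hn => ?_, fun i j hij =>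
    hmax (S i) _ fun hj => hg (S j) (hmono hij hj)⟩
  by_contra hnot
  have hpos : 0 < c n := (hc n).lt_of_ne' hn
  have hfin := eventually_cofinite.1 (h.eventually (gt_mem_nhds hpos))
  refine Set.infinite_range_of_injective hinj (hfin.subset (Set.range_subset_iff.2 fun k => ?_))
  exact not_lt.2 (hmax (S k) n fun hk => hnot (hrange k n hk))

end Rearrangement

section Basis

variable {𝕜 X : Type*} [RCLike 𝕜] [AddCommGroup X] [Module 𝕜 X] [Norm X]

theorem norm_le_mul_of_dualNorm_le [IsQuasiNorm 𝕜 X] {f : X →ₗ[𝕜] 𝕜} {c : ℝ} (hc : 0 ≤ c)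
    (hf : dualNorm f ≤ ENNReal.ofReal c) (x : X) : ‖f x‖ ≤ c * ‖x‖ := by
  rcases (IsQuasiNorm.norm_nonneg 𝕜 x).eq_or_lt with hx | hx
  · rw [(IsQuasiNorm.norm_eq_zero 𝕜 x).1 hx.symm, map_zero, norm_zero]
    exact mul_nonneg hc (IsQuasiNorm.norm_nonneg 𝕜 _)
  · have hinv : ‖((‖x‖ : ℝ) : 𝕜)⁻¹‖ = ‖x‖⁻¹ := by
      rw [norm_inv, RCLike.norm_ofReal, abs_of_pos hx]
    have hunit : ‖((‖x‖ : ℝ) : 𝕜)⁻¹ • x‖ ≤ 1 := by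
      rw [IsQuasiNorm.norm_smul, hinv, inv_mul_cancel₀ hx.ne']
    have hle := (le_iSup₂ (f := fun (x : X) (_ : ‖x‖ ≤ 1) => ENNReal.ofReal ‖f x‖) _ hunit).trans hf
    rwa [ENNReal.ofReal_le_ofReal_iff hc, map_smul, smul_eq_mul, norm_mul, hinv,
      inv_mul_le_iff₀ hx, mul_comm] at hle

namespace MBasis

variable (B : MBasis 𝕜 X)

/-- The vector `𝟏_A`, with coefficients `1` on `A` and `0` off `A`. -/
def indicator (A : Finset ℕ) : X :=
  ∑ n ∈ A, B.e n

theorem coord_indicator (n : ℕ) (A : Finset ℕ) :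
    B.coord n (B.indicator A) = if n ∈ A then 1 else 0 := by
  simp [indicator, map_sum, B.biorthogonal]

theorem coord_sum_smul (n : ℕ) (A : Finset ℕ) (b : ℕ → 𝕜) :
    B.coord n (∑ i ∈ A, b i • B.e i) = if n ∈ A then b n else 0 := by
  simp [map_sum, B.biorthogonal]

theorem coord_proj (n : ℕ) (A : Finset ℕ) (x : X) :
    B.coord n (B.proj A x) = if n ∈ A then B.coord n x else 0 :=
  B.coord_sum_smul n A fun n => B.coord n x

theorem proj_congr {A : Finset ℕ} {x y : X} (h : ∀ n ∈ A, B.coord n x = B.coord n y) :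
    B.proj A x = B.proj A y :=
  Finset.sum_congr rfl fun n hn => by rw [h n hn]

theorem proj_eq_indicator {A : Finset ℕ} {x : X} (h : ∀ n ∈ A, B.coord n x = 1) :
    B.proj A x = B.indicator A :=
  Finset.sum_congr rfl fun n hn => by rw [h n hn, one_smul]

theorem proj_sum_smul {A A' : Finset ℕ} (hA : A ⊆ A') (b : ℕ → 𝕜) :
    B.proj A' (∑ n ∈ A, b n • B.e n) = ∑ n ∈ A, b n • B.e n := by
  simp only [proj, coord_sum_smul, ite_smul, zero_smul, Finset.sum_ite_mem,
    Finset.inter_eq_right.2 hA]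

theorem proj_sub (A : Finset ℕ) (x y : X) : B.proj A (x - y) = B.proj A x - B.proj A y := by
  simp only [proj, map_sub, sub_smul, Finset.sum_sub_distrib]

theorem finite_support_coord {y : X} (hy : y ∈ Submodule.span 𝕜 (Set.range B.e)) :
    (Function.support fun n => B.coord n y).Finite := by
  obtain ⟨l, rfl⟩ := Finsupp.mem_span_range_iff_exists_finsupp.1 hy
  refine l.support.finite_toSet.subset fun n hn => ?_
  by_contra h
  exact hn ((B.coord_sum_smul n l.support l).trans (if_neg h))

theorem exists_pos_norm_e_le :
    ∃ c₁ c₂ : ℝ, 0 < c₁ ∧ 0 < c₂ ∧ ∀ n, c₁ ≤ ‖B.e n‖ ∧ ‖B.e n‖ ≤ c₂ ∧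
      dualNorm (B.coord n) ≤ ENNReal.ofReal c₂ :=
  let ⟨c₁, c₂, hc₁, hc⟩ := B.semi_normalized
  ⟨c₁, c₂, hc₁, hc₁.trans_le ((hc 0).1.1.trans (hc 0).1.2),
    fun n => ⟨(hc n).1.1, (hc n).1.2, (hc n).2.2⟩⟩

theorem tendsto_norm_coord_cofinite [IsQuasiNorm 𝕜 X] (x : X) :
    Tendsto (fun n => ‖B.coord n x‖) cofinite (𝓝 0) := by
  obtain ⟨_, c, -, hc, hdual⟩ := B.exists_pos_norm_e_le
  refine (tendsto_order.2 ⟨fun ε hε => .of_forall fun n => hε.trans_le (norm_nonneg _),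
    fun ε hε => ?_⟩)
  obtain ⟨y, hy, hxy⟩ := B.dense_span x (ε / c) (by positivity)
  refine (B.finite_support_coord hy).subset fun n hn hny => hn ?_
  calc ‖B.coord n x‖ = ‖B.coord n (x - y)‖ := by
        rw [map_sub, show B.coord n y = 0 from hny, sub_zero]
    _ ≤ c * ‖x - y‖ := norm_le_mul_of_dualNorm_le hc.le (hdual n).2.2 _
    _ < ε := by rwa [← lt_div_iff₀' hc]

variable {B} in
theorem IsUnconditional.exists_pos [IsQuasiNorm 𝕜 X] (hB : B.IsUnconditional) :
    ∃ K : ℝ, 0 < K ∧ ∀ (A : Finset ℕ) (x : X), ‖B.proj A x‖ ≤ K * ‖x‖ :=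
  let ⟨K, hK⟩ := hB
  ⟨max K 1, by positivity, fun A x => (hK A x).trans
    (mul_le_mul_of_nonneg_right (le_max_left _ _) (IsQuasiNorm.norm_nonneg 𝕜 x))⟩

variable {B} in
theorem IsUnconditional.exists_norm_sum_smul_le [IsQuasiNorm 𝕜 X] (hB : B.IsUnconditional) :
    ∃ C : ℝ, 0 < C ∧ ∀ (F : Finset ℕ) (u v : ℕ → 𝕜), (∀ n ∈ F, ‖u n‖ ≤ ‖v n‖) →
      ‖∑ n ∈ F, u n • B.e n‖ ≤ C * ‖∑ n ∈ F, v n • B.e n‖ := by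
  obtain ⟨K, hK0, hK⟩ := hB.exists_pos
  obtain ⟨κ, hκ⟩ := IsQuasiNorm.exists_isConcavityModulus 𝕜 X
  obtain ⟨b, hb⟩ := exists_nat_ge (2 * κ)
  have hκ0 : 0 < κ := one_pos.trans_le hκ.one_le
  refine ⟨(2 * κ) ^ 4 * (2 * κ) ^ b * K, by positivity, fun F u v huv => ?_⟩
  have hpartial : ∀ G ⊆ F, ‖∑ n ∈ G, v n • B.e n‖ ≤ K * ‖∑ n ∈ F, v n • B.e n‖ := fun G hG => by
    have hproj : B.proj G (∑ n ∈ F, v n • B.e n) = ∑ n ∈ G, v n • B.e n :=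
      Finset.sum_congr rfl fun n hn => by rw [coord_sum_smul, if_pos (hG hn)]
    exact hproj ▸ hK G _
  have hquot : ∀ n ∈ F, ‖u n / v n‖ ≤ 1 := fun n hn => by
    rw [norm_div]
    exact div_le_one_of_le₀ (huv n hn) (norm_nonneg _)
  have hu : ∑ n ∈ F, u n • B.e n = ∑ n ∈ F, (u n / v n) • v n • B.e n := by
    refine Finset.sum_congr rfl fun n hn => ?_
    have hzero : v n = 0 → u n = 0 := fun hv => by simpa [hv] using huv n hn
    rw [smul_smul, div_mul_cancel_of_imp hzero]
  calc ‖∑ n ∈ F, u n • B.e n‖ = ‖∑ n ∈ F, (u n / v n) • v n • B.e n‖ := by rw [hu]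
    _ ≤ (2 * κ) ^ 4 * ((2 * κ) ^ b * (K * ‖∑ n ∈ F, v n • B.e n‖)) :=
      norm_sum_smul_le hκ hpartial hb hquot
    _ = (2 * κ) ^ 4 * (2 * κ) ^ b * K * ‖∑ n ∈ F, v n • B.e n‖ := by ring

end MBasis

end Basis

section GreedySets

variable {𝕜 X : Type*} [RCLike 𝕜] [AddCommGroup X] [Module 𝕜 X] [Norm X]

namespace MBasis

variable {B : MBasis 𝕜 X}

/-- `G` is a greedy set of `x`: its coefficients are at least as large as the other ones. The errors
`γ_m(x)` are those of the projections onto greedy sets of `m` elements. -/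
def IsGreedySet (B : MBasis 𝕜 X) (x : X) (G : Finset ℕ) : Prop :=
  ∀ i ∈ G, ∀ j ∉ G, ‖B.coord j x‖ ≤ ‖B.coord i x‖

theorem IsGreedyOrdering.exists_isGreedySet {x : X} {π : ℕ → ℕ} (hπ : B.IsGreedyOrdering x π)
    (m : ℕ) : ∃ G : Finset ℕ, G.card = m ∧ B.IsGreedySet x G ∧ B.greedySum π m x = B.proj G x := by
  refine ⟨(Finset.range m).map ⟨π, hπ.injective⟩, by simp, fun i hi j hj => ?_, ?_⟩
  · obtain ⟨i, him, rfl⟩ := Finset.mem_map.1 hi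
    by_cases hcj : B.coord j x = 0
    · rw [hcj, norm_zero]
      exact norm_nonneg _
    · obtain ⟨j, rfl⟩ := hπ.support_subset j hcj
      have hmj : m ≤ j := by
        by_contra hjm
        exact hj (Finset.mem_map_of_mem _ (Finset.mem_range.2 (not_le.1 hjm)))
      exact hπ.antitone i j ((Finset.mem_range.1 him).le.trans hmj)
  · simp [greedySum, proj]

theorem gamma_le {m : ℕ} {x : X} {a : ℝ≥0∞}
    (h : ∀ G : Finset ℕ, G.card = m → B.IsGreedySet x G → ENNReal.ofReal ‖x - B.proj G x‖ ≤ a) :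
    B.gamma m x ≤ a :=
  iSup₂_le fun _ hπ =>
    let ⟨G, hGm, hG, hsum⟩ := hπ.exists_isGreedySet m
    hsum ▸ h G hGm hG

variable (B)

theorem exists_isGreedyOrdering [IsQuasiNorm 𝕜 X] (x : X) : ∃ π, B.IsGreedyOrdering x π :=
  let ⟨π, hinj, hsupp, hanti⟩ :=
    exists_injective_antitone (fun _ => norm_nonneg _) (B.tendsto_norm_coord_cofinite x)
  ⟨π, hinj, fun _ hn => hsupp (norm_ne_zero_iff.2 hn), fun _ _ hij => hanti hij⟩

theorem exists_isGreedySet_le_gamma [IsQuasiNorm 𝕜 X] (m : ℕ) (x : X) :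
    ∃ G : Finset ℕ, G.card = m ∧ B.IsGreedySet x G ∧
      ENNReal.ofReal ‖x - B.proj G x‖ ≤ B.gamma m x := by
  obtain ⟨π, hπ⟩ := B.exists_isGreedyOrdering x
  obtain ⟨G, hGm, hG, hsum⟩ := hπ.exists_isGreedySet m
  exact ⟨G, hGm, hG, hsum ▸ le_iSup₂_of_le π hπ le_rfl⟩

theorem sigma_le {m : ℕ} {A : Finset ℕ} (hA : A.card ≤ m) (b : ℕ → 𝕜) (x : X) :
    B.sigma m x ≤ ENNReal.ofReal ‖x - ∑ n ∈ A, b n • B.e n‖ := by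
  obtain ⟨A', hAA', hA'⟩ := Infinite.exists_superset_card_eq A m hA
  refine iInf₂_le_of_le A' hA' (iInf_le_of_le (fun n => if n ∈ A then b n else 0) ?_)
  simp only [ite_smul, zero_smul, Finset.sum_ite_mem, Finset.inter_eq_right.2 hAA', le_refl]

theorem sigma_le_norm (m : ℕ) (x : X) : B.sigma m x ≤ ENNReal.ofReal ‖x‖ := by
  simpa using B.sigma_le (A := ∅) (Nat.zero_le m) 0 x

theorem sigma_le_gamma [IsQuasiNorm 𝕜 X] (m : ℕ) (x : X) : B.sigma m x ≤ B.gamma m x := by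
  obtain ⟨G, hGm, -, hG⟩ := B.exists_isGreedySet_le_gamma m x
  exact (B.sigma_le hGm.le _ x).trans hG

end MBasis

end GreedySets

section Democracy

variable {𝕜 X : Type*} [RCLike 𝕜] [AddCommGroup X] [Module 𝕜 X] [Norm X]

namespace MBasis

/-- `‖𝟏_A‖ ≤ C ‖𝟏_D‖` whenever `|A| ≤ |D|`. The restriction to disjoint sets makes no difference
for unconditional bases. -/
def IsDemocratic (B : MBasis 𝕜 X) : Prop :=
  ∃ C : ℝ, ∀ A D : Finset ℕ, Disjoint A D → A.card ≤ D.card →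
    ‖B.indicator A‖ ≤ C * ‖B.indicator D‖

variable {B : MBasis 𝕜 X} [IsQuasiNorm 𝕜 X]

theorem IsDemocratic.exists_pos (hD : B.IsDemocratic) :
    ∃ C : ℝ, 0 < C ∧ ∀ A D : Finset ℕ, Disjoint A D → A.card ≤ D.card →
      ‖B.indicator A‖ ≤ C * ‖B.indicator D‖ :=
  let ⟨C, hC⟩ := hD
  ⟨max C 1, by positivity, fun A D hAD hcard => (hC A D hAD hcard).trans
    (mul_le_mul_of_nonneg_right (le_max_left _ _) (IsQuasiNorm.norm_nonneg 𝕜 _))⟩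

/-- The vector `t 𝟏_A`, with `t` the largest coefficient of `x` on `A`, dominates `P_A x`, and
`t 𝟏_D` is dominated by `P_D x`. -/
theorem IsDemocratic.exists_norm_proj_le (hD : B.IsDemocratic) (hB : B.IsUnconditional) :
    ∃ C : ℝ, 0 < C ∧ ∀ (x : X) (A D : Finset ℕ), Disjoint A D → A.card ≤ D.card →
      (∀ i ∈ A, ∀ j ∈ D, ‖B.coord i x‖ ≤ ‖B.coord j x‖) → ‖B.proj A x‖ ≤ C * ‖B.proj D x‖ := by
  obtain ⟨C, hC, hmul⟩ := hB.exists_norm_sum_smul_le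
  obtain ⟨Δ, hΔ, hdem⟩ := hD.exists_pos
  refine ⟨C * (Δ * C), by positivity, fun x A D hAD hcard hle => ?_⟩
  rcases A.eq_empty_or_nonempty with rfl | hA
  · rw [proj, Finset.sum_empty, IsQuasiNorm.norm_zero 𝕜]
    exact mul_nonneg (by positivity) (IsQuasiNorm.norm_nonneg 𝕜 _)
  obtain ⟨i, hi, hmax⟩ := A.exists_max_image (fun n => ‖B.coord n x‖) hA
  set t : 𝕜 := B.coord i x
  have hdem' : ‖∑ n ∈ A, t • B.e n‖ ≤ Δ * ‖∑ n ∈ D, t • B.e n‖ := by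
    rw [← Finset.smul_sum, ← Finset.smul_sum, IsQuasiNorm.norm_smul, IsQuasiNorm.norm_smul,
      mul_left_comm]
    exact mul_le_mul_of_nonneg_left (hdem A D hAD hcard) (norm_nonneg t)
  calc ‖B.proj A x‖ ≤ C * ‖∑ n ∈ A, t • B.e n‖ := hmul A _ _ hmax
    _ ≤ C * (Δ * ‖∑ n ∈ D, t • B.e n‖) := by gcongr
    _ ≤ C * (Δ * (C * ‖B.proj D x‖)) := by gcongr; exact hmul D _ _ (hle i hi)
    _ = C * (Δ * C) * ‖B.proj D x‖ := by ring

/-- If `G` is a greedy set of `x` and `z` is supported on a set `A` with `|A| = |G|`, then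
`x - P_G x = (x - z) - P_{A ∪ G}(x - z) + P_{A \ G} x`, and the last term is controlled by
`P_{G \ A} x = P_{G \ A}(x - z)`. -/
theorem IsDemocratic.exists_norm_sub_proj_le (hD : B.IsDemocratic) (hB : B.IsUnconditional) :
    ∃ E : ℝ, 1 ≤ E ∧ ∀ (x : X) (G A : Finset ℕ) (b : ℕ → 𝕜), B.IsGreedySet x G →
      A.card = G.card → ‖x - B.proj G x‖ ≤ E * ‖x - ∑ n ∈ A, b n • B.e n‖ := by
  obtain ⟨κ, hκ⟩ := IsQuasiNorm.exists_isConcavityModulus 𝕜 X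
  obtain ⟨K, hK0, hK⟩ := hB.exists_pos
  obtain ⟨C, hC, hcomp⟩ := hD.exists_norm_proj_le hB
  have hκ1 := hκ.one_le
  refine ⟨κ * (κ * (1 + K) + C * K), ?_, fun x G A b hG hcard => ?_⟩
  · have hfirst : 1 ≤ κ * (1 + K) := one_le_mul_of_one_le_of_one_le hκ1 (by linarith)
    exact one_le_mul_of_one_le_of_one_le hκ1
      (hfirst.trans (le_add_of_nonneg_right (by positivity)))
  set z := ∑ n ∈ A, b n • B.e n with hz
  have hsplit : x - B.proj G x =
      ((x - z) + -B.proj (A ∪ G) (x - z)) + B.proj (A \ G) x := by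
    have hunion : B.proj (A ∪ G) x = B.proj (A \ G) x + B.proj G x := by
      rw [← Finset.sdiff_union_self_eq_union]
      exact Finset.sum_union Finset.sdiff_disjoint
    rw [proj_sub, hunion, B.proj_sum_smul Finset.subset_union_left]
    abel
  have hfirst : ‖(x - z) + -B.proj (A ∪ G) (x - z)‖ ≤ κ * (1 + K) * ‖x - z‖ :=
    calc _ ≤ κ * (‖x - z‖ + ‖-B.proj (A ∪ G) (x - z)‖) := hκ.norm_add_le _ _
      _ ≤ κ * (‖x - z‖ + K * ‖x - z‖) := by
        rw [IsQuasiNorm.norm_neg 𝕜]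
        gcongr
        exact hK _ _
      _ = κ * (1 + K) * ‖x - z‖ := by ring
  have hsecond : ‖B.proj (A \ G) x‖ ≤ C * K * ‖x - z‖ :=
    calc ‖B.proj (A \ G) x‖ ≤ C * ‖B.proj (G \ A) x‖ :=
        hcomp x _ _ disjoint_sdiff_sdiff (Finset.card_sdiff_comm hcard).le fun i hi j hj =>
          hG j (Finset.mem_sdiff.1 hj).1 i (Finset.mem_sdiff.1 hi).2
      _ = C * ‖B.proj (G \ A) (x - z)‖ := by
        rw [B.proj_congr fun n hn => ?_]
        rw [map_sub, hz, coord_sum_smul, if_neg (Finset.mem_sdiff.1 hn).2, sub_zero]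
      _ ≤ C * (K * ‖x - z‖) := by gcongr; exact hK _ _
      _ = C * K * ‖x - z‖ := by ring
  calc ‖x - B.proj G x‖
      ≤ κ * (‖(x - z) + -B.proj (A ∪ G) (x - z)‖ + ‖B.proj (A \ G) x‖) :=
        hsplit ▸ hκ.norm_add_le _ _
    _ ≤ κ * (κ * (1 + K) * ‖x - z‖ + C * K * ‖x - z‖) := by gcongr
    _ = κ * (κ * (1 + K) + C * K) * ‖x - z‖ := by ring

theorem IsDemocratic.isGreedy (hD : B.IsDemocratic) (hB : B.IsUnconditional) : B.IsGreedy := by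
  obtain ⟨E, hE, hgreedy⟩ := hD.exists_norm_sub_proj_le hB
  have hE' : 1 ≤ ENNReal.ofReal E := ENNReal.one_le_ofReal.2 hE
  refine ⟨E, by linarith, fun x m _ => ⟨gamma_le fun G hGm hG => ?_,
    (B.sigma_le_gamma m x).trans (le_mul_of_one_le_left zero_le hE')⟩⟩
  rw [← ENNReal.div_le_iff' (by positivity) ENNReal.ofReal_ne_top]
  refine le_iInf₂ fun A hA => le_iInf fun b => ?_
  rw [ENNReal.div_le_iff' (by positivity) ENNReal.ofReal_ne_top,
    ← ENNReal.ofReal_mul (by linarith)]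
  exact ENNReal.ofReal_le_ofReal (hgreedy x G A b hG (hA.trans hGm.symm))

end MBasis

end Democracy

section LogMeasure

/-- The measure on `ℕ` with mass `1 / (n + 1)` at `n`, a discrete form of `dt / t`. Since sequences
are indexed from `1` in the classes, `ℓ^q` sums with weights `1 / n` are `L^q` norms for it. -/
noncomputable def logMeasure : Measure ℕ :=
  Measure.sum fun n => ((n + 1 : ℕ) : ℝ≥0∞)⁻¹ • Measure.dirac n

theorem logMeasure_singleton (n : ℕ) : logMeasure {n} = ((n + 1 : ℕ) : ℝ≥0∞)⁻¹ :=
  Measure.sum_smul_dirac_singleton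

theorem logMeasure_Ico (k m : ℕ) :
    logMeasure (Set.Ico k m) = ∑ n ∈ Finset.Ico k m, ((n + 1 : ℕ) : ℝ≥0∞)⁻¹ := by
  simp only [← Finset.coe_Ico, ← sum_measure_singleton, logMeasure_singleton]

theorem logMeasure_Ico_div_le {L : ℕ} (hL : L ≠ 0) (m : ℕ) :
    logMeasure (Set.Ico (m / L) m) ≤ L := by
  rcases Nat.eq_zero_or_pos m with rfl | hm
  · simp
  rw [logMeasure_Ico]
  calc ∑ n ∈ Finset.Ico (m / L) m, ((n + 1 : ℕ) : ℝ≥0∞)⁻¹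
      ≤ ∑ _n ∈ Finset.Ico (m / L) m, (L / m : ℝ≥0∞) := Finset.sum_le_sum fun n hn => by
        have hmn : m ≤ L * (n + 1) :=
          (Nat.lt_mul_div_succ m (Nat.pos_of_ne_zero hL)).le.trans
            (Nat.mul_le_mul_left L (Nat.succ_le_succ (Finset.mem_Ico.1 hn).1))
        rw [ENNReal.inv_le_iff_le_mul (by simp) (by simp), ← mul_div_assoc,
          ENNReal.le_div_iff_mul_le (by simp [hm.ne']) (by simp), one_mul, mul_comm]
        exact_mod_cast hmn
    _ = (m - m / L : ℕ) * (L / m : ℝ≥0∞) := by simp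
    _ ≤ m * (L / m : ℝ≥0∞) := by gcongr; exact Nat.sub_le _ _
    _ = L := ENNReal.mul_div_cancel (by simp [hm.ne']) (by simp)

theorem two_inv_le_logMeasure_Ico_div_two {m : ℕ} (hm : m ≠ 0) :
    2⁻¹ ≤ logMeasure (Set.Ico (m / 2) m) := by
  have hm' : m ≤ (m - m / 2) * 2 := by lia
  rw [logMeasure_Ico]
  calc (2 : ℝ≥0∞)⁻¹ ≤ (m - m / 2 : ℕ) * (m : ℝ≥0∞)⁻¹ := by
        rw [ENNReal.inv_le_iff_le_mul (by simp) (by simp), ← mul_assoc, mul_comm 2,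
          ← div_eq_mul_inv, ENNReal.le_div_iff_mul_le (by simp [hm]) (by simp), one_mul]
        exact_mod_cast hm'
    _ = ∑ _n ∈ Finset.Ico (m / 2) m, (m : ℝ≥0∞)⁻¹ := by simp
    _ ≤ ∑ n ∈ Finset.Ico (m / 2) m, ((n + 1 : ℕ) : ℝ≥0∞)⁻¹ :=
        Finset.sum_le_sum fun n hn => ENNReal.inv_le_inv.2
          (Nat.cast_le.2 (Finset.mem_Ico.1 hn).2)

theorem classNorm_eq_add_eLpNorm {X : Type*} [Norm X] {q : ℝ≥0∞} (hq : q ≠ 0) (ω : ℕ → ℝ)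
    (err : ℕ → X → ℝ≥0∞) (x : X) :
    classNorm ω q err x = ENNReal.ofReal ‖x‖ +
      eLpNorm (fun n => ENNReal.ofReal (ω (n + 1)) * err (n + 1) x) q logMeasure := by
  rw [classNorm]
  split_ifs with hq'
  · rw [hq', eLpNorm_exponent_top, eLpNormEssSup_eq_iSup fun n => by simp [logMeasure_singleton]]
    simp only [enorm_eq_self]
  · rw [eLpNorm_eq_lintegral_rpow_enorm_toReal hq hq', lintegral_countable']
    simp only [enorm_eq_self, logMeasure_singleton, div_eq_mul_inv]

theorem classNorm_le_mul_classNorm {X : Type*} [Norm X] {q : ℝ≥0∞} (hq : q ≠ 0) (ω : ℕ → ℝ)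
    {err err' : ℕ → X → ℝ≥0∞} {C : ℝ≥0∞} (hC : 1 ≤ C) (x : X)
    (h : ∀ m, 1 ≤ m → err m x ≤ C * err' m x) :
    classNorm ω q err x ≤ C * classNorm ω q err' x := by
  rw [classNorm_eq_add_eLpNorm hq, classNorm_eq_add_eLpNorm hq, mul_add]
  refine add_le_add (le_mul_of_one_le_left zero_le hC)
    (eLpNorm_le_mul_eLpNorm_of_ae_le_mul'' q .of_discrete (ae_of_all _ fun n => ?_))
  simp only [enorm_eq_self]
  rw [mul_left_comm]
  gcongr
  exact h _ n.succ_pos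

end LogMeasure

/-- The sequence `ω(1), ..., ω(m), 0, 0, ...`. -/
noncomputable def truncation (ω : ℕ → ℝ) (m : ℕ) : ℕ → ℝ≥0∞ :=
  (Set.Iio m).indicator fun n => ENNReal.ofReal (ω (n + 1))

namespace IsDoublingWeight

variable {ω : ℕ → ℝ}

theorem exists_one_lt_mul_le (hω : IsDoublingWeight ω) (hi : 0 < lowerDilationIndex ω) :
    ∃ (M : ℕ) (l : ℝ), 1 < M ∧ 1 < l ∧ ∀ k, 1 ≤ k → l * ω k ≤ ω (M * k) := by
  simp only [lowerDilationIndex, lt_iSup_iff] at hi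
  obtain ⟨M, hM, hlog⟩ := hi
  have hquot : ∀ k : ℕ, 0 ≤ ω (M * (k + 1)) / ω (k + 1) := fun k =>
    div_nonneg (hω.pos _ (Nat.mul_pos (by lia) k.succ_pos)).le (hω.pos _ k.succ_pos).le
  have hlogM : 0 < Real.log M := Real.log_pos (by exact_mod_cast hM)
  have hnonneg : 0 ≤ lowerDilation ω M := Real.iInf_nonneg hquot
  refine ⟨M, lowerDilation ω M, hM, ?_, fun k hk => ?_⟩
  · rw [← Real.log_pos_iff hnonneg, ← div_pos_iff_of_pos_right hlogM]
    exact_mod_cast hlog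
  · obtain ⟨k, rfl⟩ := Nat.exists_eq_add_of_le' hk
    rw [← le_div_iff₀ (hω.pos _ hk)]
    exact ciInf_le ⟨0, Set.forall_mem_range.2 hquot⟩ k

theorem exists_forall_mul_le (hω : IsDoublingWeight ω) (hi : 0 < lowerDilationIndex ω) (R : ℝ) :
    ∃ L : ℕ, 1 < L ∧ ∀ k n, 1 ≤ k → L * k ≤ n → R * ω k ≤ ω n := by
  obtain ⟨M, l, hM, hl, hdil⟩ := hω.exists_one_lt_mul_le hi
  obtain ⟨j, hj⟩ := pow_unbounded_of_one_lt R hl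
  have hpow : ∀ i k, 1 ≤ k → 1 ≤ M ^ i * k := fun i k hk =>
    Nat.mul_pos (pow_pos (by lia) i) hk
  have hiter : ∀ i k, 1 ≤ k → l ^ i * ω k ≤ ω (M ^ i * k) := by
    intro i k hk
    induction i with
    | zero => simp
    | succ i ih =>
      calc l ^ (i + 1) * ω k = l * (l ^ i * ω k) := by ring
        _ ≤ l * ω (M ^ i * k) := by gcongr
        _ ≤ ω (M * (M ^ i * k)) := hdil _ (hpow i k hk)
        _ = ω (M ^ (i + 1) * k) := by rw [← mul_assoc, pow_succ']
  refine ⟨M ^ (j + 1), one_lt_pow' hM j.succ_ne_zero, fun k n hk hn => ?_⟩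
  have hR : R ≤ l ^ (j + 1) := hj.le.trans (pow_le_pow_right₀ hl.le j.le_succ)
  calc R * ω k ≤ l ^ (j + 1) * ω k := mul_le_mul_of_nonneg_right hR (hω.pos k hk).le
    _ ≤ ω (M ^ (j + 1) * k) := hiter _ k hk
    _ ≤ ω n := hω.mono _ _ (hpow _ k hk) hn

theorem truncation_le (hω : IsDoublingWeight ω) (k m : ℕ) :
    truncation ω m ≤
      truncation ω k + (Set.Ico k m).indicator fun _ => ENNReal.ofReal (ω m) := by
  intro n
  simp only [truncation, Pi.add_apply, Set.indicator_apply, Set.mem_Iio, Set.mem_Ico]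
  by_cases hnm : n < m
  · by_cases hnk : n < k
    · simp [hnm, hnk]
    · simpa [hnm, hnk, not_lt.1 hnk] using
        ENNReal.ofReal_le_ofReal (hω.mono (n + 1) m n.succ_pos hnm)
  · simp [hnm]

/-- With `c` the quasi-triangle constant of `L^q`, choose `L` so that passing from `m / L` to `m`
multiplies `ω` by at least `2 c`. Then the terms up to `m / L` absorb into half of the bound, and
the remaining ones have bounded mass. -/
theorem exists_eLpNorm_truncation_le (hω : IsDoublingWeight ω) (hi : 0 < lowerDilationIndex ω)
    (q : ℝ≥0∞) :
    ∃ D : ℝ≥0, ∀ m, eLpNorm (truncation ω m) q logMeasure ≤ D * ENNReal.ofReal (ω m) := by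
  lift ENNReal.LpAddConst q to ℝ≥0 using (ENNReal.LpAddConst_lt_top q).ne with c hc
  obtain ⟨L, hL, hωL⟩ := hω.exists_forall_mul_le hi (2 * c)
  set b : ℝ≥0 := (L : ℝ≥0) ^ (1 / q.toReal) with hb
  refine ⟨2 * (c * b), fun m => ?_⟩
  induction m using Nat.strong_induction_on with
  | _ m ih =>
    have hhead : eLpNorm (truncation ω (m / L)) q logMeasure ≤ b * ENNReal.ofReal (ω m) := by
      rcases Nat.eq_zero_or_pos (m / L) with hk | hk
      · simp [hk, truncation]
      have hkm : m / L < m := Nat.div_lt_self (Nat.pos_of_div_pos hk) hL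
      calc eLpNorm (truncation ω (m / L)) q logMeasure
          ≤ (2 * (c * b) : ℝ≥0) * ENNReal.ofReal (ω (m / L)) := ih _ hkm
        _ = b * ENNReal.ofReal (2 * c * ω (m / L)) := by
          rw [ENNReal.ofReal_mul (by positivity), ENNReal.ofReal_mul zero_le_two,
            ENNReal.ofReal_coe_nnreal, ENNReal.ofReal_ofNat]
          push_cast
          ring
        _ ≤ b * ENNReal.ofReal (ω m) := by
          gcongr
          exact hωL _ _ hk (Nat.mul_div_le m L)
    have htail : eLpNorm ((Set.Ico (m / L) m).indicator fun _ => ENNReal.ofReal (ω m)) q logMeasure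
        ≤ b * ENNReal.ofReal (ω m) := by
      refine (eLpNorm_indicator_const_le _ q).trans ?_
      rw [enorm_eq_self, mul_comm, hb, ENNReal.coe_rpow_of_nonneg _ (by positivity)]
      gcongr
      exact_mod_cast logMeasure_Ico_div_le (by lia) m
    calc eLpNorm (truncation ω m) q logMeasure
        ≤ eLpNorm (truncation ω (m / L) +
            (Set.Ico (m / L) m).indicator fun _ => ENNReal.ofReal (ω m)) q logMeasure :=
          eLpNorm_mono_enorm fun n => by simpa using hω.truncation_le _ m n
      _ ≤ c * (b * ENNReal.ofReal (ω m) + b * ENNReal.ofReal (ω m)) := by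
          rw [hc]
          exact (eLpNorm_add_le' .of_discrete .of_discrete q).trans (by gcongr)
      _ = (2 * (c * b) : ℝ≥0) * ENNReal.ofReal (ω m) := by push_cast; ring

theorem exists_eLpNorm_mul_truncation_add_le (hω : IsDoublingWeight ω)
    (hi : 0 < lowerDilationIndex ω) (q : ℝ≥0∞) :
    ∃ D : ℝ≥0, ∀ (k m : ℕ) (a b : ℝ≥0∞),
      eLpNorm (fun n => a * truncation ω k n + b * truncation ω m n) q logMeasure ≤
        D * (ENNReal.ofReal (ω k) * a + ENNReal.ofReal (ω m) * b) := by
  lift ENNReal.LpAddConst q to ℝ≥0 using (ENNReal.LpAddConst_lt_top q).ne with c hc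
  obtain ⟨D, hD⟩ := hω.exists_eLpNorm_truncation_le hi q
  have hscale : ∀ (j : ℕ) (t : ℝ≥0∞),
      eLpNorm (fun n => t * truncation ω j n) q logMeasure ≤ D * (ENNReal.ofReal (ω j) * t) :=
    fun j t =>
      calc eLpNorm (fun n => t * truncation ω j n) q logMeasure
          ≤ t * eLpNorm (truncation ω j) q logMeasure :=
            eLpNorm_le_mul_eLpNorm_of_ae_le_mul'' (g := truncation ω j) q .of_discrete
              (ae_of_all _ fun _ => le_rfl)
        _ ≤ t * (D * ENNReal.ofReal (ω j)) := by gcongr; exact hD j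
        _ = D * (ENNReal.ofReal (ω j) * t) := by ring
  refine ⟨c * D, fun k m a b => (eLpNorm_add_le' .of_discrete .of_discrete q).trans ?_⟩
  rw [← hc]
  exact (mul_le_mul_right (add_le_add (hscale k a) (hscale m b)) _).trans_eq (by push_cast; ring)

theorem exists_classNorm_le (hω : IsDoublingWeight ω) (hi : 0 < lowerDilationIndex ω) {q : ℝ≥0∞}
    (hq : q ≠ 0) (X : Type*) [Norm X] :
    ∃ C : ℝ≥0, ∀ (err : ℕ → X → ℝ≥0∞) (x : X) (k m : ℕ) (b : ℝ≥0∞), 1 ≤ k →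
      (∀ n, err n x ≤ ENNReal.ofReal ‖x‖) → (∀ n, k ≤ n → err n x ≤ b) →
      (∀ n, m ≤ n → err n x = 0) →
      classNorm ω q err x ≤
        C * (ENNReal.ofReal (ω k) * ENNReal.ofReal ‖x‖ + ENNReal.ofReal (ω m) * b) := by
  obtain ⟨D, hD⟩ := hω.exists_eLpNorm_mul_truncation_add_le hi q
  refine ⟨(ω 1)⁻¹.toNNReal + D, fun err x k m b hk hx hb hzero => ?_⟩
  set a := ENNReal.ofReal ‖x‖
  have hpointwise : ∀ n, ENNReal.ofReal (ω (n + 1)) * err (n + 1) x ≤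
      a * truncation ω k n + b * truncation ω m n := fun n => by
    simp only [truncation, Set.indicator_apply, Set.mem_Iio]
    rcases lt_or_ge n k with hnk | hnk
    · rw [if_pos hnk, mul_comm]
      exact le_add_right (by gcongr; exact hx _)
    rcases lt_or_ge n m with hnm | hnm
    · rw [if_pos hnm, mul_comm]
      exact le_add_left (by gcongr; exact hb _ (by lia))
    · rw [hzero _ (by lia), mul_zero]
      exact zero_le
  have hnorm : a ≤ ENNReal.ofReal (ω 1)⁻¹ * (ENNReal.ofReal (ω k) * a) := by
    rw [← mul_assoc, ← ENNReal.ofReal_mul (inv_nonneg.2 (hω.pos 1 le_rfl).le)]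
    refine le_mul_of_one_le_left zero_le (ENNReal.one_le_ofReal.2 ?_)
    rw [← div_eq_inv_mul, one_le_div (hω.pos 1 le_rfl)]
    exact hω.mono 1 k le_rfl hk
  rw [classNorm_eq_add_eLpNorm hq, ENNReal.coe_add, add_mul]
  refine add_le_add (hnorm.trans ?_) ((eLpNorm_mono_enorm hpointwise).trans (hD k m a b))
  exact mul_le_mul_right le_self_add _

theorem exists_mul_le_classNorm (hω : IsDoublingWeight ω) {q : ℝ≥0∞} (hq : q ≠ 0) (X : Type*)
    [Norm X] :
    ∃ c : ℝ≥0, c ≠ 0 ∧ ∀ (err : ℕ → X → ℝ≥0∞) (x : X) (m : ℕ) (a : ℝ≥0∞), 1 ≤ m →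
      (∀ n, n ≤ m → a ≤ err n x) →
      c * (ENNReal.ofReal (ω m) * a) ≤ classNorm ω q err x := by
  obtain ⟨θ, hθ, hdbl⟩ := hω.doubling
  have hθ' : 0 < θ := by linarith
  have hle : ∀ m n, 1 ≤ m → n ∈ Set.Ico (m / 2) m →
      ENNReal.ofReal (ω m / θ) ≤ ENNReal.ofReal (ω (n + 1)) := fun m n hm hn => by
    have hmn : m ≤ 2 * (n + 1) := by have := hn.1; lia
    gcongr
    rw [div_le_iff₀' hθ']
    exact (hω.mono _ _ hm hmn).trans (hdbl _ n.succ_pos)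
  refine ⟨(2⁻¹ : ℝ≥0) ^ (1 / q.toReal) * θ.toNNReal⁻¹, by positivity,
    fun err x m a hm herr => ?_⟩
  have hmass : (2⁻¹ : ℝ≥0∞) ≤ logMeasure (Set.Ico (m / 2) m) :=
    two_inv_le_logMeasure_Ico_div_two (by lia)
  calc ((2⁻¹ : ℝ≥0) ^ (1 / q.toReal) * θ.toNNReal⁻¹ : ℝ≥0) * (ENNReal.ofReal (ω m) * a)
      = ENNReal.ofReal (ω m / θ) * a * 2⁻¹ ^ (1 / q.toReal) := by
        rw [ENNReal.ofReal_div_of_pos hθ', ENNReal.coe_mul,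
          ENNReal.coe_rpow_of_nonneg _ (by positivity), ENNReal.coe_inv two_ne_zero,
          ENNReal.coe_inv (Real.toNNReal_pos.2 hθ').ne']
        simp only [ENNReal.ofReal, ENNReal.coe_ofNat, div_eq_mul_inv]
        ring
    _ ≤ ENNReal.ofReal (ω m / θ) * a * logMeasure (Set.Ico (m / 2) m) ^ (1 / q.toReal) := by
        gcongr
    _ = eLpNorm ((Set.Ico (m / 2) m).indicator fun _ => ENNReal.ofReal (ω m / θ) * a) q
          logMeasure := by
        rw [eLpNorm_indicator_const' .of_discrete (fun h => by simp [h] at hmass) hq,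
          enorm_eq_self]
    _ ≤ eLpNorm (fun n => ENNReal.ofReal (ω (n + 1)) * err (n + 1) x) q logMeasure := by
        refine eLpNorm_mono_enorm fun n => ?_
        rw [enorm_eq_self, enorm_eq_self]
        exact Set.indicator_le' (fun n hn => mul_le_mul' (hle m n hm hn) (herr _ hn.2))
          (fun _ _ => zero_le) n
    _ ≤ classNorm ω q err x := by
        rw [classNorm_eq_add_eLpNorm hq]
        exact le_add_self

end IsDoublingWeight

section TestVector

variable {𝕜 X : Type*} [RCLike 𝕜] [AddCommGroup X] [Module 𝕜 X] [Norm X]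

namespace MBasis

variable (B : MBasis 𝕜 X)

/-- The vector `𝟏_A + 2 𝟏_D` with `A` and `D` disjoint. Its greedy sets of at most `|D|` elements
lie in `D`, while approximation by `|A|` terms can remove `𝟏_A`. -/
noncomputable def testVector (A D : Finset ℕ) : X :=
  B.indicator A + (2 : 𝕜) • B.indicator D

theorem coord_testVector (n : ℕ) (A D : Finset ℕ) :
    B.coord n (B.testVector A D) = (if n ∈ A then 1 else 0) + 2 * (if n ∈ D then 1 else 0) := by
  rw [testVector, map_add, map_smul, coord_indicator, coord_indicator, smul_eq_mul]

theorem proj_union_testVector (A D : Finset ℕ) :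
    B.proj (A ∪ D) (B.testVector A D) = B.testVector A D := by
  simp only [proj, coord_testVector, add_smul, ite_smul, mul_ite, mul_one, mul_zero, one_smul,
    zero_smul, Finset.sum_add_distrib, Finset.sum_ite_mem, Finset.union_inter_cancel_left,
    Finset.union_inter_cancel_right, ← Finset.smul_sum]
  rfl

theorem sigma_testVector_eq_zero [IsQuasiNorm 𝕜 X] {A D : Finset ℕ} {m : ℕ}
    (hm : A.card + D.card ≤ m) : B.sigma m (B.testVector A D) = 0 := by
  have hle := B.sigma_le ((Finset.card_union_le A D).trans hm)
    (fun n => B.coord n (B.testVector A D)) (B.testVector A D)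
  rw [← proj, proj_union_testVector, sub_self, IsQuasiNorm.norm_zero 𝕜, ENNReal.ofReal_zero] at hle
  exact le_zero_iff.1 hle

theorem sigma_testVector_le [IsQuasiNorm 𝕜 X] {A D : Finset ℕ} {m : ℕ} (hm : A.card ≤ m) :
    B.sigma m (B.testVector A D) ≤ ENNReal.ofReal (2 * ‖B.indicator D‖) := by
  have hle := B.sigma_le hm 1 (B.testVector A D)
  simp only [Pi.one_apply, one_smul] at hle
  rwa [← indicator, testVector, add_sub_cancel_left, IsQuasiNorm.norm_smul, RCLike.norm_ofNat]
    at hle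

theorem IsGreedySet.subset_of_testVector {A D G : Finset ℕ} (hAD : Disjoint A D)
    (hG : B.IsGreedySet (B.testVector A D) G) (hcard : G.card ≤ D.card) : G ⊆ D := by
  intro i hi
  by_contra hiD
  obtain ⟨j, hjD, hjG⟩ : ∃ j ∈ D, j ∉ G := by
    by_contra! hDG
    exact hiD (Finset.eq_of_subset_of_card_le hDG hcard ▸ hi)
  have hle := hG i hi j hjG
  rw [coord_testVector, coord_testVector, if_neg (Finset.disjoint_right.1 hAD hjD), if_pos hjD,
    if_neg hiD] at hle
  split_ifs at hle <;> norm_num at hle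

theorem norm_indicator_div_le_gamma_testVector [IsQuasiNorm 𝕜 X] {K : ℝ} (hK0 : 0 < K)
    (hK : ∀ (A : Finset ℕ) (x : X), ‖B.proj A x‖ ≤ K * ‖x‖) {A D : Finset ℕ}
    (hAD : Disjoint A D) {m : ℕ} (hm : m ≤ D.card) :
    ENNReal.ofReal (‖B.indicator A‖ / K) ≤ B.gamma m (B.testVector A D) := by
  obtain ⟨G, hGm, hG, hle⟩ := B.exists_isGreedySet_le_gamma m (B.testVector A D)
  have hGD := hG.subset_of_testVector B hAD (hGm.trans_le hm)
  refine le_trans (ENNReal.ofReal_le_ofReal ((div_le_iff₀' hK0).2 ?_)) hle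
  have hproj : B.proj A (B.testVector A D - B.proj G (B.testVector A D)) = B.indicator A := by
    refine B.proj_eq_indicator fun n hn => ?_
    have hnD := Finset.disjoint_left.1 hAD hn
    rw [map_sub, coord_proj, coord_testVector, if_pos hn, if_neg hnD,
      if_neg fun hnG => hnD (hGD hnG), mul_zero, add_zero, sub_zero]
  exact hproj ▸ hK A _

theorem norm_testVector_le [IsQuasiNorm 𝕜 X] {κ : ℝ} (hκ : IsConcavityModulus X κ)
    (A D : Finset ℕ) :
    ‖B.testVector A D‖ ≤ 2 * κ * (‖B.indicator A‖ + ‖B.indicator D‖) := by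
  have hκ1 := hκ.one_le
  have hA := IsQuasiNorm.norm_nonneg 𝕜 (B.indicator A)
  calc ‖B.testVector A D‖ ≤ κ * (‖B.indicator A‖ + ‖(2 : 𝕜) • B.indicator D‖) :=
        hκ.norm_add_le _ _
    _ = κ * (‖B.indicator A‖ + 2 * ‖B.indicator D‖) := by
        rw [IsQuasiNorm.norm_smul, RCLike.norm_ofNat]
    _ ≤ 2 * κ * (‖B.indicator A‖ + ‖B.indicator D‖) := by nlinarith

end MBasis

end TestVector

section Converse

variable {𝕜 X : Type*} [RCLike 𝕜] [AddCommGroup X] [Module 𝕜 X] [Norm X] [IsQuasiNorm 𝕜 X]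
  {B : MBasis 𝕜 X} {ω : ℕ → ℝ} {q : ℝ≥0∞}

namespace MBasis

variable (B) in
theorem exists_approxNorm_testVector_le (hω : IsDoublingWeight ω) (hi : 0 < lowerDilationIndex ω)
    (hq : q ≠ 0) :
    ∃ C : ℝ, 0 < C ∧ ∀ A D : Finset ℕ, A.Nonempty →
      B.approxNorm ω q (B.testVector A D) ≤
        ENNReal.ofReal (C * (ω A.card * (‖B.indicator A‖ + ‖B.indicator D‖) +
          ω (A.card + D.card) * ‖B.indicator D‖)) := by
  obtain ⟨κ, hκ⟩ := IsQuasiNorm.exists_isConcavityModulus 𝕜 X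
  obtain ⟨U, hU⟩ := hω.exists_classNorm_le hi hq X
  have hκ1 := hκ.one_le
  refine ⟨(U + 1) * (2 * κ), by positivity, fun A D hA => ?_⟩
  set x := B.testVector A D
  have hnx := IsQuasiNorm.norm_nonneg 𝕜 x
  have hβ := IsQuasiNorm.norm_nonneg 𝕜 (B.indicator D)
  have hωA := (hω.pos _ hA.card_pos).le
  have hωAD := (hω.pos (A.card + D.card) (Nat.add_pos_left hA.card_pos _)).le
  calc B.approxNorm ω q x
      ≤ U * (ENNReal.ofReal (ω A.card) * ENNReal.ofReal ‖x‖ +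
          ENNReal.ofReal (ω (A.card + D.card)) * ENNReal.ofReal (2 * ‖B.indicator D‖)) :=
        hU B.sigma x _ _ _ hA.card_pos (fun n => B.sigma_le_norm n x)
          (fun n hn => B.sigma_testVector_le hn) (fun n hn => B.sigma_testVector_eq_zero hn)
    _ = ENNReal.ofReal (U * (ω A.card * ‖x‖ +
          ω (A.card + D.card) * (2 * ‖B.indicator D‖))) := by
        rw [ENNReal.ofReal_mul U.coe_nonneg, ENNReal.ofReal_add (by positivity) (by positivity),
          ENNReal.ofReal_mul hωA, ENNReal.ofReal_mul hωAD, ENNReal.ofReal_coe_nnreal]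
    _ ≤ ENNReal.ofReal ((U + 1) * (ω A.card *
          (2 * κ * (‖B.indicator A‖ + ‖B.indicator D‖)) +
          ω (A.card + D.card) * (2 * κ * ‖B.indicator D‖))) := by
        gcongr
        · exact le_add_of_nonneg_right zero_le_one
        · exact B.norm_testVector_le hκ A D
        · exact le_mul_of_one_le_right zero_le_two hκ1
    _ = _ := by congr 1; ring

theorem IsUnconditional.exists_le_greedyNorm_testVector (hB : B.IsUnconditional)
    (hω : IsDoublingWeight ω) (hq : q ≠ 0) :
    ∃ c : ℝ, 0 < c ∧ ∀ A D : Finset ℕ, Disjoint A D → D.Nonempty →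
      ENNReal.ofReal (c * (ω D.card * ‖B.indicator A‖)) ≤
        B.greedyNorm ω q (B.testVector A D) := by
  obtain ⟨K, hK0, hK⟩ := hB.exists_pos
  obtain ⟨c, hc, hlower⟩ := hω.exists_mul_le_classNorm hq X
  have hc0 : (0 : ℝ) < c := NNReal.coe_pos.2 (pos_iff_ne_zero.2 hc)
  refine ⟨c / K, div_pos hc0 hK0, fun A D hAD hD => ?_⟩
  calc ENNReal.ofReal (c / K * (ω D.card * ‖B.indicator A‖))
      = ENNReal.ofReal (c * (ω D.card * (‖B.indicator A‖ / K))) := by congr 1; ring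
    _ = c * (ENNReal.ofReal (ω D.card) * ENNReal.ofReal (‖B.indicator A‖ / K)) := by
        rw [ENNReal.ofReal_mul c.coe_nonneg, ENNReal.ofReal_mul (hω.pos _ hD.card_pos).le,
          ENNReal.ofReal_coe_nnreal]
    _ ≤ B.greedyNorm ω q (B.testVector A D) :=
        hlower B.gamma _ _ _ hD.card_pos fun n hn =>
          B.norm_indicator_div_le_gamma_testVector hK0 hK hAD hn

theorem exists_mul_norm_indicator_le_of_embeds (hω : IsDoublingWeight ω)
    (hi : 0 < lowerDilationIndex ω) (hq : q ≠ 0) (hB : B.IsUnconditional)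
    (hemb : Embeds (B.approxNorm ω q) (B.greedyNorm ω q)) :
    ∃ E : ℝ, 0 < E ∧ ∀ A D : Finset ℕ, Disjoint A D → A.Nonempty → D.Nonempty →
      ω D.card * ‖B.indicator A‖ ≤
        E * (ω A.card * (‖B.indicator A‖ + ‖B.indicator D‖) +
          ω (A.card + D.card) * ‖B.indicator D‖) := by
  obtain ⟨-, C, hC, hle⟩ := hemb
  obtain ⟨U, hU, happrox⟩ := B.exists_approxNorm_testVector_le hω hi hq
  obtain ⟨c, hc, hgreedy⟩ := hB.exists_le_greedyNorm_testVector hω hq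
  refine ⟨C * U / c, by positivity, fun A D hAD hA hD => ?_⟩
  have hα := IsQuasiNorm.norm_nonneg 𝕜 (B.indicator A)
  have hβ := IsQuasiNorm.norm_nonneg 𝕜 (B.indicator D)
  have hωA := (hω.pos _ hA.card_pos).le
  have hωAD := (hω.pos (A.card + D.card) (Nat.add_pos_left hA.card_pos _)).le
  have happroxAD := happrox A D hA
  rw [div_mul_eq_mul_div, le_div_iff₀' hc, mul_assoc C,
    ← ENNReal.ofReal_le_ofReal_iff (by positivity), ENNReal.ofReal_mul hC.le]
  calc ENNReal.ofReal (c * (ω D.card * ‖B.indicator A‖))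
      ≤ B.greedyNorm ω q (B.testVector A D) := hgreedy A D hAD hD
    _ ≤ ENNReal.ofReal C * B.approxNorm ω q (B.testVector A D) :=
        hle _ (happroxAD.trans_lt ENNReal.ofReal_lt_top)
    _ ≤ _ := mul_le_mul_right happroxAD _

/-- By the index condition, `|D|` large compared to `|A|` makes `ω(|A|)` so small compared to
`ω(|D|)` that the term with `‖𝟏_A‖` in the bound can be absorbed. -/
theorem exists_norm_indicator_le_of_embeds (hω : IsDoublingWeight ω)
    (hi : 0 < lowerDilationIndex ω) (hq : q ≠ 0) (hB : B.IsUnconditional)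
    (hemb : Embeds (B.approxNorm ω q) (B.greedyNorm ω q)) :
    ∃ (L : ℕ) (C : ℝ), 1 < L ∧ 0 < C ∧ ∀ A D : Finset ℕ, Disjoint A D → L * A.card ≤ D.card →
      ‖B.indicator A‖ ≤ C * ‖B.indicator D‖ := by
  obtain ⟨E, hE, hkey⟩ := exists_mul_norm_indicator_le_of_embeds hω hi hq hB hemb
  obtain ⟨L, hL, hωL⟩ := hω.exists_forall_mul_le hi (2 * E)
  obtain ⟨θ, hθ, hdbl⟩ := hω.doubling
  refine ⟨L, 1 + 2 * E * θ, hL, by positivity, fun A D hAD hcard => ?_⟩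
  have hα := IsQuasiNorm.norm_nonneg 𝕜 (B.indicator A)
  have hβ := IsQuasiNorm.norm_nonneg 𝕜 (B.indicator D)
  rcases A.eq_empty_or_nonempty with rfl | hA
  · rw [indicator, Finset.sum_empty, IsQuasiNorm.norm_zero 𝕜]
    positivity
  have hA0 := hA.card_pos
  have hAD_card : A.card ≤ D.card := (Nat.le_mul_of_pos_left _ (by lia)).trans hcard
  have hD0 : 0 < D.card := hA0.trans_le hAD_card
  have hωD := hω.pos _ hD0
  have hωAD : ω (A.card + D.card) ≤ θ * ω D.card :=
    (hω.mono _ _ (by lia) (by lia)).trans (hdbl _ hD0)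
  refine le_of_mul_le_mul_left ?_ hωD
  have hsum : 2 * E * ω A.card * (‖B.indicator A‖ + ‖B.indicator D‖) ≤
      ω D.card * (‖B.indicator A‖ + ‖B.indicator D‖) := by
    gcongr
    exact hωL _ _ hA0 hcard
  have hunion : E * (ω (A.card + D.card) * ‖B.indicator D‖) ≤
      E * (θ * ω D.card * ‖B.indicator D‖) := by gcongr
  linarith [hkey A D hAD hA (Finset.card_pos.1 hD0)]

theorem IsUnconditional.exists_norm_e_le_mul_norm_indicator (hB : B.IsUnconditional) :
    ∃ C : ℝ, 0 < C ∧ ∀ (n : ℕ) (D : Finset ℕ), D.Nonempty → ‖B.e n‖ ≤ C * ‖B.indicator D‖ := by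
  obtain ⟨K, hK0, hK⟩ := hB.exists_pos
  obtain ⟨c₁, c₂, hc₁, hc₂, hc⟩ := B.exists_pos_norm_e_le
  refine ⟨c₂ / c₁ * K, by positivity, fun n D ⟨j, hj⟩ => ?_⟩
  have hproj : B.proj {j} (B.indicator D) = B.e j := by
    rw [proj, Finset.sum_singleton, coord_indicator, if_pos hj, one_smul]
  calc ‖B.e n‖ ≤ c₂ / c₁ * c₁ := by rw [div_mul_cancel₀ _ hc₁.ne']; exact (hc n).2.1
    _ ≤ c₂ / c₁ * ‖B.e j‖ := by gcongr; exact (hc j).1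
    _ ≤ c₂ / c₁ * (K * ‖B.indicator D‖) := by gcongr; exact hproj ▸ hK {j} _
    _ = c₂ / c₁ * K * ‖B.indicator D‖ := by ring

/-- A set `A` with `|A| ≤ |D|` is the union of `2 L` sets of at most `max 1 (|D| / L)` elements. -/
theorem IsUnconditional.isDemocratic_of_forall_mul_card_le (hB : B.IsUnconditional) {L : ℕ}
    (hL : 0 < L) {C : ℝ} (hC : ∀ A D : Finset ℕ, Disjoint A D → L * A.card ≤ D.card →
      ‖B.indicator A‖ ≤ C * ‖B.indicator D‖) : B.IsDemocratic := by
  obtain ⟨κ, hκ⟩ := IsQuasiNorm.exists_isConcavityModulus 𝕜 X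
  obtain ⟨C', hC', hsingle⟩ := hB.exists_norm_e_le_mul_norm_indicator
  refine ⟨(2 * κ) ^ (2 * L) * max C C', fun A D hAD hcard => ?_⟩
  have hβ := IsQuasiNorm.norm_nonneg 𝕜 (B.indicator D)
  have hmod : D.card ≤ 2 * L * max 1 (D.card / L) :=
    calc D.card ≤ L * (D.card / L + 1) := (Nat.lt_mul_div_succ _ hL).le
      _ ≤ L * (max 1 (D.card / L) + max 1 (D.card / L)) := by gcongr <;> simp
      _ = 2 * L * max 1 (D.card / L) := by ring
  rw [mul_assoc]
  refine hκ.norm_sum_le_of_card_le_mul B.e (max 1 (D.card / L)) (2 * L) (hcard.trans hmod)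
    fun t htA ht => ?_
  rcases le_max_iff.1 ht with ht1 | htL
  · rcases t.eq_empty_or_nonempty with rfl | hne
    · rw [Finset.sum_empty, IsQuasiNorm.norm_zero 𝕜]
      positivity
    · obtain ⟨i, rfl⟩ := Finset.card_eq_one.1 (ht1.antisymm hne.card_pos)
      have hD : D.Nonempty := Finset.card_pos.1
        ((Finset.card_pos.2 (hne.mono htA)).trans_le hcard)
      rw [Finset.sum_singleton]
      exact (hsingle i D hD).trans (by gcongr; exact le_max_right _ _)
  · have hmul : L * t.card ≤ D.card := (Nat.mul_le_mul_left L htL).trans (Nat.mul_div_le _ _)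
    exact (hC t D (Finset.disjoint_of_subset_left htA hAD) hmul).trans
      (by gcongr; exact le_max_left _ _)

end MBasis

end Converse

section Equivalence

theorem embeds_of_le {X : Type*} {Φ Ψ : X → ℝ≥0∞} {C : ℝ} (hC : 0 < C)
    (h : ∀ x, Ψ x ≤ ENNReal.ofReal C * Φ x) : Embeds Φ Ψ :=
  ⟨fun x hx => (h x).trans_lt (ENNReal.mul_lt_top ENNReal.ofReal_lt_top hx),
    C, hC, fun x _ => h x⟩

theorem embeds_classNorm_of_le {X : Type*} [Norm X] {q : ℝ≥0∞} (hq : q ≠ 0) (ω : ℕ → ℝ)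
    {err err' : ℕ → X → ℝ≥0∞} {C : ℝ}
    (h : ∀ x m, 1 ≤ m → err' m x ≤ ENNReal.ofReal C * err m x) :
    Embeds (classNorm ω q err) (classNorm ω q err') :=
  embeds_of_le (C := max C 1) (by positivity) fun x =>
    classNorm_le_mul_classNorm hq ω (ENNReal.one_le_ofReal.2 (le_max_right _ _)) x fun m hm =>
      (h x m hm).trans (by gcongr; exact le_max_left _ _)

namespace MBasis

variable {𝕜 X : Type*} [RCLike 𝕜] [AddCommGroup X] [Module 𝕜 X] [Norm X] {B : MBasis 𝕜 X}
  {q : ℝ≥0∞}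

theorem IsGreedy.equivalentSpaces (hB : B.IsGreedy) (ω : ℕ → ℝ) (hq : q ≠ 0) :
    EquivalentSpaces (B.approxNorm ω q) (B.greedyNorm ω q) :=
  let ⟨_, _, h⟩ := hB
  ⟨embeds_classNorm_of_le hq ω fun x m hm => (h x m hm).1,
    embeds_classNorm_of_le hq ω fun x m hm => (h x m hm).2⟩

theorem IsUnconditional.isGreedy_of_embeds [IsQuasiNorm 𝕜 X] (hB : B.IsUnconditional) {ω : ℕ → ℝ}
    (hω : IsDoublingWeight ω) (hi : 0 < lowerDilationIndex ω) (hq : q ≠ 0)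
    (hemb : Embeds (B.approxNorm ω q) (B.greedyNorm ω q)) : B.IsGreedy :=
  let ⟨_, _, hL, _, hlarge⟩ := exists_norm_indicator_le_of_embeds hω hi hq hB hemb
  (hB.isDemocratic_of_forall_mul_card_le (one_pos.trans hL) hlarge).isGreedy hB

end MBasis

end Equivalence

end GreedyApprox

theorem theorem1p4_general {𝕜 X : Type*} [RCLike 𝕜] [AddCommGroup X] [Module 𝕜 X] [Norm X]
    [GreedyApprox.IsQuasiNorm 𝕜 X] (ω : ℕ → ℝ) (hω : GreedyApprox.IsDoublingWeight ω)
    (hi : 0 < GreedyApprox.lowerDilationIndex ω) (B : GreedyApprox.MBasis 𝕜 X)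
    (hB : B.IsUnconditional) :
    (B.IsGreedy → ∀ q : ℝ≥0∞, 0 < q →
      GreedyApprox.EquivalentSpaces (B.approxNorm ω q) (B.greedyNorm ω q)) ∧
    ((∃ q : ℝ≥0∞, 0 < q ∧
      GreedyApprox.Embeds (B.approxNorm ω q) (B.greedyNorm ω q)) → B.IsGreedy) :=
  ⟨fun hgreedy _ hq => hgreedy.equivalentSpaces ω hq.ne',
    fun ⟨_, hq, hemb⟩ => hB.isGreedy_of_embeds hω hi hq.ne' hemb⟩

theorem theorem1p4 {𝕜 X : Type*} [RCLike 𝕜] [AddCommGroup X] [Module 𝕜 X] [Norm X]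
    [GreedyApprox.IsQuasiBanach 𝕜 X]
    (ω : ℕ → ℝ) (hω : GreedyApprox.IsDoublingWeight ω)
    (hi : 0 < GreedyApprox.lowerDilationIndex ω)
    (B : GreedyApprox.MBasis 𝕜 X) (hB : B.IsUnconditional) :
    (B.IsGreedy → ∀ q : ℝ≥0∞, 0 < q →
      GreedyApprox.EquivalentSpaces (B.approxNorm ω q) (B.greedyNorm ω q)) ∧
    ((∃ q : ℝ≥0∞, 0 < q ∧
      GreedyApprox.EquivalentSpaces (B.approxNorm ω q) (B.greedyNorm ω q)) → B.IsGreedy) :=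
  let ⟨hdirect, hconverse⟩ := theorem1p4_general ω hω hi B hB
  ⟨hdirect, fun ⟨q, hq, hequiv⟩ => hconverse ⟨q, hq, hequiv.1⟩⟩
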